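/- Let $n,m,l\in\mathbb N$, and let $\Phi:\mathbb M_n\to\mathbb M_l$ and $\Psi:\mathbb M_m\to\mathbb M_l$ be positive linear maps between complex matrix algebras (that is, linear maps sending positive semidefinite matrices to positive semidefinite matrices). For a positive semidefinite $X\in\mathbb M_l$ write $\lambda(X)=(\lambda_1(X),\dots,\lambda_l(X))$ for its eigenvalues in decreasing order, counted with multiplicity; powers and products of such vectors are taken entrywise. For vectors $a,b$ with $a_1\ge\dots\ge a_l\ge0$ and $b_1\ge\dots\ge b_l\ge0$, write $a\prec_{w(\log)}b$ if $\prod_{i=1}^k a_i\le\prod_{i=1}^k b_i$ for all $1\le k\le l$. Powers of positive semidefinite matrices are defined by functional calculus, with the convention $x^0=1$ for all $x\ge0$ (so $A^0=I$). Let $0\le\alpha\le1$. Then for all positive semidefinite $A\in\mathbb M_n$ and $B\in\mathbb M_m$, $$\lambda\bigl(\Phi(A^\alpha)^{1/2}\Psi(B^\alpha)\Phi(A^\alpha)^{1/2}\bigr)\prec_{w(\log)}\lambda^{1-\alpha}\bigl(\Phi(I_n)^{1/2}\Psi(I_m)\Phi(I_n)^{1/2}\bigr)\,\lambda^{\alpha}\bigl(\Phi(A)^{1/2}\Psi(B)\Phi(A)^{1/2}\bigr).$$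 Consequently, if $\Phi(I_n)^{1/2}\Psi(I_m)\Phi(I_n)^{1/2}\le I_l$ (in the positive semidefinite order), then for all positive semidefinite $A\in\mathbb M_n$ and $B\in\mathbb M_m$, $$\lambda\bigl(\Phi(A^\alpha)^{1/2}\Psi(B^\alpha)\Phi(A^\alpha)^{1/2}\bigr)\prec_{w(\log)}\lambda^{\alpha}\bigl(\Phi(A)^{1/2}\Psi(B)\Phi(A)^{1/2}\bigr).$$ -/

import Mathlib

open scoped MatrixOrder ComplexOrder

/-- The complex `n × n` matrices. -/
abbrev CMat (n : ℕ) : Type := Matrix (Fin n) (Fin n) ℂ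

/-- `X^{1/2} Y X^{1/2}`. Real powers of positive semidefinite matrices are taken in the functional
calculus, with `x ^ 0 = 1` for all `x ≥ 0` (so `X ^ 0` is the identity matrix). -/
noncomputable def sandwich {l : ℕ} (X Y : CMat l) : CMat l :=
  X ^ (1 / 2 : ℝ) * Y * X ^ (1 / 2 : ℝ)

theorem sandwich_posSemidef {l : ℕ} (X : CMat l) {Y : CMat l} (hY : Y.PosSemidef) :
    (sandwich X Y).PosSemidef := by
  have h : (X ^ (1 / 2 : ℝ)).PosSemidef := Matrix.nonneg_iff_posSemidef.mp CFC.rpow_nonneg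
  have h2 := hY.mul_mul_conjTranspose_same (X ^ (1 / 2 : ℝ))
  rw [h.isHermitian.eq] at h2
  exact h2

open Classical in
/-- The eigenvalues `λ_1(A) ≥ … ≥ λ_n(A)` of a Hermitian matrix `A`, in decreasing order and
counted with multiplicity; the index `i : Fin n` stands for the usual index `i + 1`.
(For a matrix that is not Hermitian the value is the irrelevant default `0`.) -/
noncomputable def eigs {n : ℕ} (A : CMat n) : Fin n → ℝ := fun i =>
  if hA : A.IsHermitian then hA.eigenvalues₀ (Fin.cast (Fintype.card_fin n).symm i) else 0

/-- Weak log-majorization `a ≺_{w(log)} b` of decreasingly ordered nonnegative vectors: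
`a_1 ⋯ a_k ≤ b_1 ⋯ b_k` for `1 ≤ k ≤ n`. -/
def WeakLogMaj {n : ℕ} (a b : Fin n → ℝ) : Prop :=
  ∀ k : ℕ, 1 ≤ k → k ≤ n →
    ∏ i : Fin n with i.val < k, a i ≤ ∏ i : Fin n with i.val < k, b i

/-! Spectral decomposition `A = ∑ aᵢ Eᵢ` and a factorization of each `Φ Eᵢ` give a single `G` with
`Φ (A ^ t) = Gᴴ diag(a ^ t) G` for every `t`; likewise `Ψ (B ^ t) = Hᴴ diag(b ^ t) H`. The
eigenvalues of the sandwich are then squared singular values of `diag(b ^ (t/2)) H Gᴴ diag(a ^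
(t/2))`, apart from zeros. The product of the `k` largest is the maximum of `|det (Uᴴ ⋯ V)|²` over
contractions `U`, `V` with `k` columns (`sq_norm_det_le_prod_eigs`,
`exists_isometries_prod_eigs_eq`).

Fix `U`, `V` extremal at `t = α` and replace `t` by a complex `z`. The determinant becomes an entire
function, bounded on the strip `0 ≤ Re z ≤ 1`. On the two edges the imaginary powers are diagonal
contractions, absorbed into `U` and `V`, so the maximum principle for `t = 0` and `t = 1` bounds it
there. Hadamard's three lines theorem interpolates at `α`. -/

open Matrix

/-! ### Loewner order, contractions and determinants. -/

section Loewner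

variable {m n : Type*} [Fintype m] [Fintype n]

theorem conjTranspose_mul_mul_mono {A B : Matrix m m ℂ} (h : A ≤ B) (C : Matrix m n ℂ) :
    Cᴴ * A * C ≤ Cᴴ * B * C := by
  rw [Matrix.le_iff] at h ⊢
  simpa [Matrix.mul_sub, Matrix.sub_mul] using h.conjTranspose_mul_mul_same C

theorem conjTranspose_mul_self_nonneg (C : Matrix m n ℂ) : 0 ≤ Cᴴ * C :=
  (posSemidef_conjTranspose_mul_self C).nonneg

variable [DecidableEq m] [DecidableEq n]

/-- `1 - XXᴴ = (1 - XXᴴ)² + X (1 - XᴴX) Xᴴ`, a sum of two positive terms. -/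
theorem mul_conjTranspose_le_one {X : Matrix m n ℂ} (h : Xᴴ * X ≤ 1) : X * Xᴴ ≤ 1 := by
  have h1 := conjTranspose_mul_mul_mono h Xᴴ
  have h2 := conjTranspose_mul_self_nonneg (1 - X * Xᴴ)
  have h3 : 1 - X * Xᴴ = (1 - X * Xᴴ)ᴴ * (1 - X * Xᴴ) +
      (Xᴴᴴ * (1 : Matrix n n ℂ) * Xᴴ - Xᴴᴴ * (Xᴴ * X) * Xᴴ) := by
    simp only [conjTranspose_sub, conjTranspose_one, conjTranspose_mul, conjTranspose_conjTranspose,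
      Matrix.mul_one, Matrix.sub_mul, Matrix.mul_sub, Matrix.one_mul, Matrix.mul_assoc]
    abel
  rw [← sub_nonneg, h3]
  exact add_nonneg h2 (sub_nonneg.2 h1)

theorem conjTranspose_mul_contraction_mul_le {U : Matrix m n ℂ} (hU : Uᴴ * U ≤ 1)
    {p : Type*} [Fintype p] (C : Matrix m p ℂ) :
    (Uᴴ * C)ᴴ * (Uᴴ * C) ≤ Cᴴ * C := by
  simpa [Matrix.mul_assoc] using conjTranspose_mul_mul_mono (mul_conjTranspose_le_one hU) C

theorem re_det_le_one {A : Matrix n n ℂ} (h0 : 0 ≤ A) (h1 : A ≤ 1) : A.det.re ≤ 1 := by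
  have hA : A.PosSemidef := nonneg_iff_posSemidef.1 h0
  have hev : ∀ i, hA.isHermitian.eigenvalues i ≤ 1 := by
    intro i
    have := (Matrix.le_iff.1 h1).re_dotProduct_nonneg (hA.isHermitian.eigenvectorBasis i)
    rw [Matrix.sub_mulVec, hA.isHermitian.mulVec_eigenvectorBasis, Matrix.one_mulVec,
      dotProduct_sub, dotProduct_smul] at this
    have h2 := (hA.isHermitian.eigenvectorBasis).orthonormal.1 i
    have h3 : star (hA.isHermitian.eigenvectorBasis i : n → ℂ) ⬝ᵥ
        (hA.isHermitian.eigenvectorBasis i : n → ℂ) = 1 := by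
      rw [dotProduct_comm, ← EuclideanSpace.inner_eq_star_dotProduct, inner_self_eq_norm_sq_to_K, h2]
      simp
    rw [h3] at this
    simpa using this
  rw [hA.isHermitian.det_eq_prod_eigenvalues]
  simp only [Complex.coe_algebraMap]
  rw [← Complex.ofReal_prod, Complex.ofReal_re]
  exact Finset.prod_le_one (fun i _ => hA.eigenvalues_nonneg i) fun i _ => hev i

theorem exists_eq_conjTranspose_mul_self {A : Matrix n n ℂ} (h : 0 ≤ A) :
    ∃ T : Matrix n n ℂ, A = Tᴴ * T := by
  refine ⟨CFC.sqrt A, ?_⟩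
  have h1 : (CFC.sqrt A)ᴴ = CFC.sqrt A :=
    (nonneg_iff_posSemidef.1 (CFC.sqrt_nonneg A)).isHermitian
  rw [h1, CFC.sqrt_mul_sqrt_self A h]

/-- Writing `B = TᴴT` with `T` invertible, congruence by `T⁻¹` reduces to the case `B = 1`. -/
theorem re_det_le_re_det {A B : Matrix n n ℂ} (h0 : 0 ≤ A) (h : A ≤ B) (hB : B.PosDef) :
    A.det.re ≤ B.det.re := by
  obtain ⟨T, rfl⟩ := exists_eq_conjTranspose_mul_self hB.posSemidef.nonneg
  have hT : IsUnit T.det := by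
    have := (Matrix.isUnit_iff_isUnit_det _).1 hB.isUnit
    rw [det_mul] at this
    exact isUnit_of_mul_isUnit_right this
  have hTH : IsUnit Tᴴ.det := by rw [det_conjTranspose]; exact hT.star
  have e1 : (T⁻¹)ᴴ * (Tᴴ * T) * T⁻¹ = 1 := by
    rw [Matrix.conjTranspose_nonsing_inv, Matrix.mul_assoc, Matrix.mul_assoc,
      Matrix.mul_nonsing_inv _ hT, Matrix.mul_one, Matrix.nonsing_inv_mul _ hTH]
  have h1 := conjTranspose_mul_mul_mono h T⁻¹
  have h2 := conjTranspose_mul_mul_mono h0 T⁻¹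
  rw [e1] at h1
  rw [Matrix.mul_zero, Matrix.zero_mul] at h2
  have h3 := re_det_le_one h2 h1
  have e2 : A = Tᴴ * ((T⁻¹)ᴴ * A * T⁻¹) * T := by
    rw [Matrix.conjTranspose_nonsing_inv, Matrix.mul_assoc, Matrix.mul_assoc, Matrix.mul_assoc,
      Matrix.nonsing_inv_mul _ hT, Matrix.mul_one, ← Matrix.mul_assoc,
      Matrix.mul_nonsing_inv _ hTH, Matrix.one_mul]
  have hdet : (Tᴴ * T).det = ((Complex.normSq T.det : ℝ) : ℂ) := by
    rw [det_mul, det_conjTranspose, Complex.normSq_eq_conj_mul_self]; rfl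
  have e3 : A.det = (Tᴴ * T).det * ((T⁻¹)ᴴ * A * T⁻¹).det := by
    conv_lhs => rw [e2]
    simp only [det_mul]; ring
  rw [e3, hdet, Complex.re_ofReal_mul, Complex.ofReal_re]
  exact mul_le_of_le_one_right (Complex.normSq_nonneg _) h3

/-- With `max (d i) c = c (1 + e i ²)`, the contraction `X` gives `L ≤ c (1 + (EX)ᴴ(EX))`.
Sylvester's identity turns the determinant into that of `1 + EXXᴴE ≤ 1 + E²`, which is diagonal. The
free level `c` is later placed at the `k`-th eigenvalue. -/
theorem re_det_conj_diagonal_le {X : Matrix m n ℂ} (hX : Xᴴ * X ≤ 1) (d : m → ℝ) {c : ℝ}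
    (hc : 0 < c) (L : Matrix n n ℂ) (hL0 : 0 ≤ L)
    (hL : L ≤ Xᴴ * diagonal (fun i => (d i : ℂ)) * X) :
    L.det.re ≤ c ^ Fintype.card n * ∏ i, (max (d i) c / c) := by
  set e : m → ℝ := fun i => √((max (d i) c - c) / c) with he
  have he2 : ∀ i, e i * e i = (max (d i) c - c) / c := fun i =>
    Real.mul_self_sqrt (div_nonneg (sub_nonneg.2 (le_max_right _ _)) hc.le)
  set E : Matrix m m ℂ := diagonal (fun i => (e i : ℂ)) with hE
  have hEH : Eᴴ = E := by
    rw [hE, diagonal_conjTranspose]; congr 1; ext i; simp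
  have hEE : E * E = diagonal (fun i => (((max (d i) c - c) / c : ℝ) : ℂ)) := by
    rw [hE, diagonal_mul_diagonal]; congr 1; ext i; rw [← Complex.ofReal_mul, he2]
  have hcC : (0 : ℂ) ≤ (c : ℂ) := by exact_mod_cast hc.le
  have hD : diagonal (fun i => (d i : ℂ)) ≤ (c : ℂ) • (1 + E * E) := by
    rw [Matrix.le_iff, hEE, ← diagonal_one, diagonal_add, ← diagonal_smul, diagonal_sub]
    refine PosSemidef.diagonal fun i => ?_
    have : (0 : ℝ) ≤ c * (1 + (max (d i) c - c) / c) - d i := by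
      have : c * (1 + (max (d i) c - c) / c) = max (d i) c := by field_simp; ring
      rw [this]; exact sub_nonneg.2 (le_max_left _ _)
    simp only [Pi.zero_apply, Pi.smul_apply, smul_eq_mul]
    exact_mod_cast this
  have hY : 0 ≤ (E * X)ᴴ * (E * X) := conjTranspose_mul_self_nonneg _
  have hle : L ≤ (c : ℂ) • (1 + (E * X)ᴴ * (E * X)) := by
    refine hL.trans ((conjTranspose_mul_mul_mono hD X).trans ?_)
    have : (c : ℂ) • (1 + (E * X)ᴴ * (E * X)) - Xᴴ * ((c : ℂ) • (1 + E * E)) * X =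
        (c : ℂ) • (1 - Xᴴ * X) := by
      rw [conjTranspose_mul, hEH]
      simp only [Matrix.mul_smul, Matrix.smul_mul, Matrix.mul_add, Matrix.add_mul, Matrix.mul_one,
        Matrix.mul_assoc, ← smul_sub]
      congr 1; abel
    rw [← sub_nonneg, this]
    exact ((Matrix.le_iff.1 hX).smul hcC).nonneg
  have hpd : ((c : ℂ) • (1 + (E * X)ᴴ * (E * X))).PosDef :=
    (PosDef.one.add_posSemidef (nonneg_iff_posSemidef.1 hY)).smul (by exact_mod_cast hc)
  refine (re_det_le_re_det hL0 hle hpd).trans ?_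
  rw [det_smul, Matrix.det_one_add_mul_comm, ← Complex.ofReal_pow, Complex.re_ofReal_mul]
  refine mul_le_mul_of_nonneg_left ?_ (pow_nonneg hc.le _)
  have h4 : 1 + E * X * (E * X)ᴴ ≤ 1 + E * E := by
    refine add_le_add_right ?_ 1
    have := conjTranspose_mul_mul_mono (mul_conjTranspose_le_one hX) E
    rw [conjTranspose_mul]
    simpa [hEH, Matrix.mul_assoc] using this
  have h5 : (0 : Matrix m m ℂ) ≤ 1 + E * X * (E * X)ᴴ :=
    add_nonneg PosSemidef.one.nonneg (posSemidef_self_mul_conjTranspose _).nonneg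
  have h6 : (1 + E * E).PosDef := by
    have := conjTranspose_mul_self_nonneg E
    rw [hEH] at this
    exact PosDef.one.add_posSemidef (nonneg_iff_posSemidef.1 this)
  refine (re_det_le_re_det h5 h4 h6).trans (le_of_eq ?_)
  rw [hEE, ← diagonal_one, diagonal_add, det_diagonal]
  have : ∀ i, (1 : ℂ) + (((max (d i) c - c) / c : ℝ) : ℂ) = ((max (d i) c / c : ℝ) : ℂ) := by
    intro i
    rw [← Complex.ofReal_one, ← Complex.ofReal_add]
    congr 1; field_simp; ring
  simp_rw [this]
  rw [← Complex.ofReal_prod, Complex.ofReal_re]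

end Loewner

/-! ### Ordered eigenvalues, pseudoinverses and square roots. -/

theorem exists_unitary_eigs {l : ℕ} {S : CMat l} (hS : S.IsHermitian) :
    ∃ W : CMat l, Wᴴ * W = 1 ∧ W * Wᴴ = 1 ∧
      S = W * diagonal (fun i => (eigs S i : ℂ)) * Wᴴ := by
  set σ : Fin l ≃ Fin l := (finCongr (Fintype.card_fin l).symm).trans
    (Fintype.equivOfCardEq (Fintype.card_fin _)) with hσ
  have hev : ∀ i, eigs S i = hS.eigenvalues (σ i) := by
    intro i
    simp [eigs, dif_pos hS, IsHermitian.eigenvalues, hσ]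
  set U : CMat l := (hS.eigenvectorUnitary : CMat l) with hU
  have h1 : Uᴴ * U = 1 := Unitary.coe_star_mul_self hS.eigenvectorUnitary
  have h2 : U * Uᴴ = 1 := Unitary.coe_mul_star_self hS.eigenvectorUnitary
  have h3 : S = U * diagonal (fun i => (hS.eigenvalues i : ℂ)) * Uᴴ := by
    have := hS.spectral_theorem
    rw [Unitary.conjStarAlgAut_apply] at this
    exact this
  refine ⟨U.submatrix id σ, ?_, ?_, ?_⟩
  · rw [conjTranspose_submatrix, ← submatrix_mul _ _ _ _ _ Function.bijective_id, h1]
    exact submatrix_one_equiv σ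
  · rw [conjTranspose_submatrix, ← submatrix_mul _ _ _ _ _ σ.bijective, h2, submatrix_id_id]
  · have : diagonal (fun i => (eigs S i : ℂ)) =
        (diagonal (fun i => (hS.eigenvalues i : ℂ))).submatrix σ σ := by
      rw [submatrix_diagonal_equiv]
      congr 1; ext i; simp [hev]
    rw [this, conjTranspose_submatrix, ← submatrix_mul _ _ _ _ _ σ.bijective,
      ← submatrix_mul _ _ _ _ _ σ.bijective, submatrix_id_id]
    exact h3

theorem eigs_antitone {l : ℕ} (S : CMat l) : Antitone (eigs S) := by
  intro i j hij
  unfold eigs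
  split_ifs with h
  · exact h.eigenvalues₀_antitone (by simpa using hij)
  · exact le_rfl

theorem eigs_nonneg {l : ℕ} {S : CMat l} (hS : S.PosSemidef) (i : Fin l) : 0 ≤ eigs S i := by
  obtain ⟨W, h1, -, h3⟩ := exists_unitary_eigs hS.isHermitian
  have h4 := hS.conjTranspose_mul_mul_same W
  have h5 : Wᴴ * S * W = diagonal (fun i => (eigs S i : ℂ)) := by
    conv_lhs => rw [h3]
    rw [Matrix.mul_assoc, Matrix.mul_assoc, h1, Matrix.mul_one, ← Matrix.mul_assoc, h1,
      Matrix.one_mul]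
  rw [h5, posSemidef_diagonal_iff] at h4
  exact_mod_cast h4 i

theorem eigs_le_one {l : ℕ} {S : CMat l} (hS : S.PosSemidef) (h : S ≤ 1) (i : Fin l) :
    eigs S i ≤ 1 := by
  obtain ⟨W, h1, -, h3⟩ := exists_unitary_eigs hS.isHermitian
  have h4 := conjTranspose_mul_mul_mono h W
  have h5 : Wᴴ * S * W = diagonal (fun i => (eigs S i : ℂ)) := by
    conv_lhs => rw [h3]
    rw [Matrix.mul_assoc, Matrix.mul_assoc, h1, Matrix.mul_one, ← Matrix.mul_assoc, h1,
      Matrix.one_mul]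
  rw [h5, Matrix.mul_one, h1, Matrix.le_iff, ← diagonal_one, diagonal_sub,
    posSemidef_diagonal_iff] at h4
  have := h4 i
  rw [sub_nonneg] at this
  exact_mod_cast this

theorem prod_filter_val_lt {M : Type*} [CommMonoid M] {k l : ℕ} (hk : k ≤ l) (f : Fin l → M) :
    ∏ i : Fin l with i.val < k, f i = ∏ j : Fin k, f (Fin.castLE hk j) := by
  symm
  refine Finset.prod_bij (fun j _ => Fin.castLE hk j) (by simp) ?_ ?_ (by simp)
  · intro a _ b _ h
    exact Fin.castLE_injective hk h
  · intro b hb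
    exact ⟨⟨b.val, (Finset.mem_filter.1 hb).2⟩, Finset.mem_univ _, rfl⟩

theorem exists_pseudoinverse {l : ℕ} {R : CMat l} (hR : R.IsHermitian) :
    ∃ T : CMat l, Tᴴ = T ∧ R * T * R = R ∧ R * T = T * R := by
  obtain ⟨W, h1, -, h3⟩ := exists_unitary_eigs hR
  set d := fun i => (eigs R i : ℂ) with hd
  have key : ∀ X Y : CMat l, W * X * Wᴴ * (W * Y * Wᴴ) = W * (X * Y) * Wᴴ := by
    intro X Y
    calc _ = W * X * (Wᴴ * W) * Y * Wᴴ := by simp only [Matrix.mul_assoc]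
      _ = _ := by rw [h1, Matrix.mul_one]; simp only [Matrix.mul_assoc]
  refine ⟨W * diagonal (fun i => (d i)⁻¹) * Wᴴ, ?_, ?_, ?_⟩
  · simp only [conjTranspose_mul, conjTranspose_conjTranspose, diagonal_conjTranspose,
      Matrix.mul_assoc]
    congr 3; ext i; simp [hd]
  · rw [h3, key, key, diagonal_mul_diagonal, diagonal_mul_diagonal]
    congr 3; ext i
    by_cases h : d i = 0 <;> simp [h]
  · rw [h3, key, key, diagonal_mul_diagonal, diagonal_mul_diagonal]
    simp only [mul_comm]

/-- Douglas factorization: `C = TY` with `T` the pseudoinverse of `R`. The projection `1 - RT` kills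
`R`, hence also `Y`, because `YYᴴ ≤ R²`. -/
theorem exists_contraction_factor {l : ℕ} {R : CMat l} (hR : R.IsHermitian) {p : Type*} [Fintype p]
    [DecidableEq p] {Y : Matrix (Fin l) p ℂ} (h : Y * Yᴴ ≤ R * R) :
    ∃ C : Matrix (Fin l) p ℂ, Cᴴ * C ≤ 1 ∧ Y = R * C := by
  obtain ⟨T, hT, hRTR, hcomm⟩ := exists_pseudoinverse hR
  have hsq : R * T * (R * T) = R * T := by rw [← Matrix.mul_assoc, hRTR]
  have hherm : (R * T)ᴴ = R * T := by rw [conjTranspose_mul, hT, hR.eq, hcomm]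
  have hle : R * T ≤ 1 := by
    have h1 := conjTranspose_mul_self_nonneg (1 - R * T)
    have h2 : (1 - R * T)ᴴ * (1 - R * T) = 1 - R * T := by
      rw [conjTranspose_sub, conjTranspose_one, hherm, Matrix.sub_mul, Matrix.mul_sub,
        Matrix.mul_sub, hsq]
      simp
    rw [h2] at h1
    exact sub_nonneg.1 h1
  refine ⟨T * Y, ?_, ?_⟩
  · have h1 := conjTranspose_mul_mul_mono h T
    have h2 : Tᴴ * (R * R) * T = R * T := by
      rw [hT, ← Matrix.mul_assoc, ← hcomm, Matrix.mul_assoc, hsq]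
    rw [h2] at h1
    have h3 : (T * Y)ᴴᴴ * (T * Y)ᴴ ≤ 1 := by
      refine le_trans (le_of_eq ?_) (h1.trans hle)
      simp only [conjTranspose_mul, hT, conjTranspose_conjTranspose, Matrix.mul_assoc]
    simpa using mul_conjTranspose_le_one h3
  · have h1 := conjTranspose_mul_mul_mono h (1 - R * T)
    have h2 : (1 - R * T) * R = 0 := by rw [Matrix.sub_mul, hRTR, Matrix.one_mul, sub_self]
    have h3 : (1 - R * T)ᴴ = 1 - R * T := by rw [conjTranspose_sub, conjTranspose_one, hherm]
    have h4 : (1 - R * T) * Y * ((1 - R * T) * Y)ᴴ = 0 := by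
      refine le_antisymm ?_ (posSemidef_self_mul_conjTranspose _).nonneg
      refine le_trans (le_of_eq ?_) (h1.trans (le_of_eq ?_))
      · rw [conjTranspose_mul, h3]; simp only [Matrix.mul_assoc]
      · rw [h3, ← Matrix.mul_assoc, h2]; simp
    have h5 := self_mul_conjTranspose_eq_zero.1 h4
    rw [Matrix.sub_mul, Matrix.one_mul, sub_eq_zero] at h5
    rw [← Matrix.mul_assoc]; exact h5

theorem rpow_half_isHermitian {l : ℕ} (X : CMat l) : (X ^ (1 / 2 : ℝ)).IsHermitian :=
  (nonneg_iff_posSemidef.mp CFC.rpow_nonneg).isHermitian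

theorem rpow_half_mul_self {l : ℕ} {X : CMat l} (hX : 0 ≤ X) :
    X ^ (1 / 2 : ℝ) * X ^ (1 / 2 : ℝ) = X := by
  rw [← CFC.sqrt_eq_rpow]
  exact CFC.sqrt_mul_sqrt_self X hX

/-! ### Variational formula for the product of the `k` largest eigenvalues. -/

section Compound

variable {M N : Type*} [Fintype M] [Fintype N]

theorem prod_max_div_le {k l : ℕ} (hk1 : 1 ≤ k) (hk : k ≤ l) {f : Fin l → ℝ} (hf : Antitone f)
    {ε : ℝ} (hε : 0 < ε) (hf0 : ∀ i, 0 ≤ f i) :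
    ∃ c > 0, c ^ k * ∏ i, (max (f i) c / c) ≤ ∏ i : Fin l with i.val < k, (f i + ε) := by
  set i₀ : Fin l := ⟨k - 1, by omega⟩
  -- The `k`-th largest entry (index `k - 1`), shifted by `ε` to be positive. Entries beyond it
  -- contribute factors `1`, and `c ^ k` cancels the remaining denominators.
  set c := f i₀ + ε with hc
  have hc0 : 0 < c := add_pos_of_nonneg_of_pos (hf0 _) hε
  refine ⟨c, hc0, ?_⟩
  have h1 : ∏ i, (max (f i) c / c) = ∏ i : Fin l with i.val < k, (max (f i) c / c) := by
    symm
    refine Finset.prod_subset (Finset.filter_subset _ _) fun i _ hi => ?_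
    have hi' : k ≤ i.val := by simpa using hi
    have : f i ≤ c := (hf (show i₀ ≤ i from Fin.le_def.2 (by simp [i₀]; omega))).trans (by linarith)
    rw [max_eq_right this, div_self hc0.ne']
  rw [h1, prod_filter_val_lt hk, prod_filter_val_lt hk, Finset.prod_div_distrib, Finset.prod_const,
    Finset.card_univ, Fintype.card_fin, mul_div_cancel₀ _ (pow_pos hc0 k).ne']
  refine Finset.prod_le_prod (fun j _ => hc0.le.trans (le_max_right _ _)) fun j _ => ?_
  refine max_le (by linarith) ?_
  have : f i₀ ≤ f (Fin.castLE hk j) := hf (Fin.le_def.2 (by simp [i₀]; omega))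
  linarith

/-- Since `GᴴVVᴴG ≤ GᴴG = R²`, Douglas gives `GᴴV = RC` with `C` a contraction, so the compressed
matrix `Z` satisfies `ZᴴZ ≤ CᴴSC`. The determinant bound is then applied in an eigenbasis of `S`. -/
theorem sq_norm_det_le_prod_eigs [DecidableEq M] [DecidableEq N] {k l : ℕ} (hk1 : 1 ≤ k) (hk : k ≤ l) (G : Matrix N (Fin l) ℂ)
    (H : Matrix M (Fin l) ℂ) {U : Matrix M (Fin k) ℂ} {V : Matrix N (Fin k) ℂ}
    (hU : Uᴴ * U ≤ 1) (hV : Vᴴ * V ≤ 1) :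
    ‖(Uᴴ * (H * Gᴴ) * V).det‖ ^ 2 ≤
      ∏ i : Fin l with i.val < k, eigs (sandwich (Gᴴ * G) (Hᴴ * H)) i := by
  set S := sandwich (Gᴴ * G) (Hᴴ * H) with hS
  have hSpsd : S.PosSemidef := sandwich_posSemidef _ (posSemidef_conjTranspose_mul_self H)
  set R : CMat l := (Gᴴ * G) ^ (1 / 2 : ℝ) with hR
  have hRH : R.IsHermitian := rpow_half_isHermitian _
  have hRR : R * R = Gᴴ * G := rpow_half_mul_self (conjTranspose_mul_self_nonneg G)
  have hY : (Gᴴ * V) * (Gᴴ * V)ᴴ ≤ R * R := by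
    rw [hRR]
    simpa [Matrix.mul_assoc] using conjTranspose_mul_mul_mono (mul_conjTranspose_le_one hV) G
  obtain ⟨C, hC, hYC⟩ := exists_contraction_factor hRH hY
  obtain ⟨W, hW1, hW2, hWS⟩ := exists_unitary_eigs hSpsd.isHermitian
  set Z := Uᴴ * (H * Gᴴ) * V with hZ
  have hX : (Wᴴ * C)ᴴ * (Wᴴ * C) ≤ 1 := by
    refine le_trans (le_of_eq ?_) hC
    calc _ = Cᴴ * (W * Wᴴ) * C := by simp [Matrix.mul_assoc]
      _ = _ := by rw [hW2, Matrix.mul_one]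
  have hL : Zᴴ * Z ≤ (Wᴴ * C)ᴴ * diagonal (fun i => (eigs S i : ℂ)) * (Wᴴ * C) := by
    have e1 : Z = Uᴴ * (H * (R * C)) := by rw [← hYC, hZ]; simp only [Matrix.mul_assoc]
    rw [e1]
    refine (conjTranspose_mul_contraction_mul_le hU _).trans (le_of_eq ?_)
    calc (H * (R * C))ᴴ * (H * (R * C)) = Cᴴ * S * C := by
          simp only [hS, sandwich, ← hR, conjTranspose_mul, hRH.eq, Matrix.mul_assoc]
      _ = Cᴴ * (W * diagonal (fun i => (eigs S i : ℂ)) * Wᴴ) * C := by rw [← hWS]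
      _ = _ := by simp [Matrix.mul_assoc]
  have hdet : (Zᴴ * Z).det.re = ‖Z.det‖ ^ 2 := by
    rw [det_mul, det_conjTranspose, ← Complex.normSq_eq_norm_sq, ← Complex.ofReal_re
      (Complex.normSq Z.det), Complex.normSq_eq_conj_mul_self]
    rfl
  have hε : ∀ ε : ℝ, 0 < ε → ‖Z.det‖ ^ 2 ≤ ∏ i : Fin l with i.val < k, (eigs S i + ε) := by
    intro ε hε
    obtain ⟨c, hc, hle⟩ := prod_max_div_le hk1 hk (eigs_antitone S) hε (eigs_nonneg hSpsd)
    rw [← hdet]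
    refine le_trans ?_ hle
    simpa using re_det_conj_diagonal_le hX (eigs S) hc _ (conjTranspose_mul_self_nonneg Z) hL
  have hcont : Filter.Tendsto (fun ε : ℝ => ∏ i : Fin l with i.val < k, (eigs S i + ε))
      (nhdsWithin 0 (Set.Ioi 0)) (nhds (∏ i : Fin l with i.val < k, eigs S i)) := by
    have : Continuous (fun ε : ℝ => ∏ i : Fin l with i.val < k, (eigs S i + ε)) := by fun_prop
    have h := this.tendsto 0
    simp only [add_zero] at h
    exact h.mono_left nhdsWithin_le_nhds
  exact ge_of_tendsto hcont (Filter.eventually_of_mem self_mem_nhdsWithin hε)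

theorem exists_isometries_prod_eigs_eq {k l : ℕ} (hk : k ≤ l) (G : Matrix N (Fin l) ℂ)
    (H : Matrix M (Fin l) ℂ)
    (hpos : ∀ i : Fin l, i.val < k → 0 < eigs (sandwich (Gᴴ * G) (Hᴴ * H)) i) :
    ∃ (U : Matrix M (Fin k) ℂ) (V : Matrix N (Fin k) ℂ), Uᴴ * U = 1 ∧ Vᴴ * V = 1 ∧
      ‖(Uᴴ * (H * Gᴴ) * V).det‖ ^ 2 =
        ∏ i : Fin l with i.val < k, eigs (sandwich (Gᴴ * G) (Hᴴ * H)) i := by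
  set S := sandwich (Gᴴ * G) (Hᴴ * H) with hS
  have hSpsd : S.PosSemidef := sandwich_posSemidef _ (posSemidef_conjTranspose_mul_self H)
  set R : CMat l := (Gᴴ * G) ^ (1 / 2 : ℝ) with hR
  have hRH : Rᴴ = R := rpow_half_isHermitian _
  have hRR : R * R = Gᴴ * G := rpow_half_mul_self (conjTranspose_mul_self_nonneg G)
  obtain ⟨W, hW1, hW2, hWS⟩ := exists_unitary_eigs hSpsd.isHermitian
  set μ : Fin k → ℝ := fun j => eigs S (Fin.castLE hk j) with hμ
  have hμ0 : ∀ j, 0 < μ j := fun j => hpos _ (by simp)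
  set w : Matrix (Fin l) (Fin k) ℂ := W.submatrix id (Fin.castLE hk) with hw
  have hww : wᴴ * w = 1 := by
    rw [hw, conjTranspose_submatrix, ← submatrix_mul _ _ _ _ _ Function.bijective_id, hW1]
    exact submatrix_one _ (Fin.castLE_injective hk)
  have hSw : S * w = w * diagonal (fun j => (μ j : ℂ)) := by
    have h1 : S * W = W * diagonal (fun i => (eigs S i : ℂ)) := by
      conv_lhs => rw [hWS]
      rw [Matrix.mul_assoc, hW1, Matrix.mul_one]
    ext i j
    have h2 := congrFun (congrFun h1 i) (Fin.castLE hk j)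
    rw [mul_diagonal] at h2
    rw [mul_diagonal]
    exact h2
  have hwS : wᴴ * S = diagonal (fun j => (μ j : ℂ)) * wᴴ := by
    have := congrArg conjTranspose hSw
    rw [conjTranspose_mul, conjTranspose_mul, hSpsd.isHermitian.eq, diagonal_conjTranspose] at this
    rw [this]; congr 2; ext j; simp
  have hS2 : S = R * (Hᴴ * H) * R := rfl
  set D : Matrix (Fin k) (Fin k) ℂ := diagonal (fun j => ((√(μ j))⁻¹ : ℂ)) with hD
  set E : Matrix (Fin k) (Fin k) ℂ := diagonal (fun j => ((μ j)⁻¹ : ℂ)) with hE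
  have hDH : Dᴴ = D := by rw [hD, diagonal_conjTranspose]; congr 1; ext j; simp
  have hEH : Eᴴ = E := by rw [hE, diagonal_conjTranspose]; congr 1; ext j; simp
  have hsqrt : ∀ j, ((√(μ j) : ℝ) : ℂ) * (√(μ j) : ℝ) = μ j := fun j => by
    rw [← Complex.ofReal_mul, Real.mul_self_sqrt (hμ0 j).le]
  have hs0 : ∀ j, ((√(μ j) : ℝ) : ℂ) ≠ 0 := fun j => by
    exact_mod_cast (Real.sqrt_pos.2 (hμ0 j)).ne'
  have hm0 : ∀ j, (μ j : ℂ) ≠ 0 := fun j => by exact_mod_cast (hμ0 j).ne'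
  -- The leading left and right singular vectors of `HGᴴ`: with `w` the top eigenvectors of `S =
  -- RHᴴHR`, the columns of `HRw` have length `√μ` and those of `GHᴴHRw` have length `μ`.
  refine ⟨H * R * w * D, G * (Hᴴ * H * R * w * E), ?_, ?_, ?_⟩
  · calc (H * R * w * D)ᴴ * (H * R * w * D) = D * (wᴴ * S) * w * D := by
          simp only [hS2, conjTranspose_mul, hRH, hDH, Matrix.mul_assoc]
      _ = D * diagonal (fun j => (μ j : ℂ)) * (wᴴ * w) * D := by
          rw [hwS]; simp only [Matrix.mul_assoc]
      _ = 1 := by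
          rw [hww, Matrix.mul_one, diagonal_mul_diagonal, diagonal_mul_diagonal, ← diagonal_one]
          congr 1; ext j
          rw [← hsqrt j]; field_simp [hs0 j]
  · calc (G * (Hᴴ * H * R * w * E))ᴴ * (G * (Hᴴ * H * R * w * E))
          = E * wᴴ * R * (Hᴴ * H) * (Gᴴ * G) * (Hᴴ * H) * R * w * E := by
          simp only [conjTranspose_mul, conjTranspose_conjTranspose, hRH, hEH, Matrix.mul_assoc]
      _ = E * (wᴴ * S) * (S * w) * E := by
          rw [← hRR]; simp only [hS2, Matrix.mul_assoc]
      _ = E * diagonal (fun j => (μ j : ℂ)) * (wᴴ * w) * diagonal (fun j => (μ j : ℂ)) * E := by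
          rw [hwS, hSw]; simp only [Matrix.mul_assoc]
      _ = 1 := by
          rw [hww, Matrix.mul_one, diagonal_mul_diagonal, diagonal_mul_diagonal,
            diagonal_mul_diagonal, ← diagonal_one]
          congr 1; ext j
          field_simp [hm0 j]
  · have : (H * R * w * D)ᴴ * (H * Gᴴ) * (G * (Hᴴ * H * R * w * E)) =
        diagonal (fun j => ((√(μ j) : ℝ) : ℂ)) := by
      calc (H * R * w * D)ᴴ * (H * Gᴴ) * (G * (Hᴴ * H * R * w * E))
          = D * wᴴ * R * (Hᴴ * H) * (Gᴴ * G) * (Hᴴ * H) * R * w * E := by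
            simp only [conjTranspose_mul, hRH, hDH, Matrix.mul_assoc]
        _ = D * (wᴴ * S) * (S * w) * E := by
            rw [← hRR]; simp only [hS2, Matrix.mul_assoc]
        _ = D * diagonal (fun j => (μ j : ℂ)) * (wᴴ * w) * diagonal (fun j => (μ j : ℂ)) * E := by
            rw [hwS, hSw]; simp only [Matrix.mul_assoc]
        _ = _ := by
            rw [hww, Matrix.mul_one, diagonal_mul_diagonal, diagonal_mul_diagonal,
              diagonal_mul_diagonal]
            congr 1; ext j
            rw [← hsqrt j]; field_simp [hs0 j]
    rw [this, det_diagonal, prod_filter_val_lt hk, norm_prod, ← Finset.prod_pow]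
    refine Finset.prod_congr rfl fun j _ => ?_
    rw [Complex.norm_real, Real.norm_eq_abs, sq_abs, Real.sq_sqrt (hμ0 j).le]

end Compound

/-! ### Factorizations of `Φ (A ^ t)` with `t` only in diagonal weights. -/

theorem rpow_eq_sum_spectral {n : ℕ} {A : CMat n} (hA : A.PosSemidef) (t : ℝ) :
    A ^ t = ∑ i, ((hA.isHermitian.eigenvalues i ^ t : ℝ) : ℂ) •
      ((hA.isHermitian.eigenvectorUnitary : CMat n) * Matrix.single i i 1 *
        (hA.isHermitian.eigenvectorUnitary : CMat n)ᴴ) := by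
  rw [CFC.rpow_eq_cfc_real hA.nonneg, hA.isHermitian.cfc_eq, IsHermitian.cfc,
    Unitary.conjStarAlgAut_apply]
  have : diagonal (RCLike.ofReal ∘ (fun x : ℝ => x ^ t) ∘ hA.isHermitian.eigenvalues) =
      ∑ i, ((hA.isHermitian.eigenvalues i ^ t : ℝ) : ℂ) • (Matrix.single i i 1 : CMat n) := by
    ext i j
    rw [Matrix.sum_apply]
    by_cases h : i = j
    · subst h; simp [Matrix.single_apply]
    · simp only [diagonal_apply_ne _ h, Matrix.smul_apply, Matrix.single_apply]
      refine (Finset.sum_eq_zero fun c _ => ?_).symm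
      rw [if_neg fun hc => h (hc.1.symm.trans hc.2), smul_zero]
  rw [this, Matrix.mul_sum, Matrix.sum_mul]
  simp only [Matrix.mul_smul, Matrix.smul_mul]
  rfl

theorem conjTranspose_diagonal_ofReal {ι : Type*} [DecidableEq ι] (r : ι → ℝ) :
    (diagonal (fun p => (r p : ℂ)))ᴴ = diagonal (fun p => (r p : ℂ)) := by
  rw [diagonal_conjTranspose]; congr 1; ext i; simp

section Weighted

variable {M N : Type*} [Fintype M] [Fintype N] [DecidableEq M] [DecidableEq N]

/-- The Gram matrix of the columns of `G` for the inner product with weights `w`. -/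
noncomputable def weightedGram {l : ℕ} (G : Matrix N (Fin l) ℂ) (w : N → ℝ) : CMat l :=
  Gᴴ * (diagonal (fun p => (w p : ℂ)) * G)

theorem conjTranspose_diagonal_mul_self {l : ℕ} (G : Matrix N (Fin l) ℂ) (r : N → ℝ) :
    (diagonal (fun p => (r p : ℂ)) * G)ᴴ * (diagonal (fun p => (r p : ℂ)) * G) =
      weightedGram G (fun p => r p ^ 2) := by
  rw [conjTranspose_mul, conjTranspose_diagonal_ofReal, weightedGram, Matrix.mul_assoc,
    ← Matrix.mul_assoc (diagonal _), diagonal_mul_diagonal]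
  congr 3; ext p; push_cast; ring

/-- `G` stacks the blocks `Tᵢ` with `Φ Eᵢ = TᵢᴴTᵢ`, where `Eᵢ` are the rank-one spectral projections
of `A`. These do not depend on `t`. Positivity of `Φ` suffices, without complete positivity. -/
theorem PositiveLinearMap.exists_factorization {n l : ℕ} (Φ : CMat n →ₚ[ℂ] CMat l) {A : CMat n}
    (hA : A.PosSemidef) :
    ∃ (a : Fin n → ℝ) (G : Matrix (Fin n × Fin l) (Fin l) ℂ), (∀ i, 0 ≤ a i) ∧
      ∀ t : ℝ, Φ (A ^ t) = weightedGram G (fun p => a p.1 ^ t) := by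
  set W : CMat n := (hA.isHermitian.eigenvectorUnitary : CMat n)
  have hE : ∀ i, 0 ≤ W * Matrix.single i i 1 * Wᴴ := by
    intro i
    have h1 : (Matrix.single i i 1 : CMat n).PosSemidef := by
      rw [← diagonal_single]
      refine PosSemidef.diagonal fun j => ?_
      by_cases h : j = i
      · subst h; simp
      · simp [h]
    exact (h1.mul_mul_conjTranspose_same W).nonneg
  choose T hT using fun i => exists_eq_conjTranspose_mul_self (Φ.map_nonneg (hE i))
  refine ⟨hA.isHermitian.eigenvalues, Matrix.of fun p q => T p.1 p.2 q, hA.eigenvalues_nonneg,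
    fun t => ?_⟩
  rw [rpow_eq_sum_spectral hA, map_sum]
  simp only [map_smul]
  ext q r
  rw [Matrix.sum_apply, weightedGram, Matrix.mul_apply, Fintype.sum_prod_type]
  refine Finset.sum_congr rfl fun i _ => ?_
  rw [Matrix.smul_apply, hT i, Matrix.mul_apply, smul_eq_mul, Finset.mul_sum]
  refine Finset.sum_congr rfl fun p _ => ?_
  rw [diagonal_mul]
  simp only [conjTranspose_apply, Matrix.of_apply]
  ring

theorem contraction_diagonal_mul {p : Type*} [Fintype p] [DecidableEq p] {θ : N → ℂ}
    (hθ : ∀ i, ‖θ i‖ ≤ 1) {V : Matrix N p ℂ} (hV : Vᴴ * V ≤ 1) :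
    (diagonal θ * V)ᴴ * (diagonal θ * V) ≤ 1 := by
  have h1 : diagonal (fun i => star (θ i) * θ i) ≤ 1 := by
    rw [Matrix.le_iff, ← diagonal_one, diagonal_sub]
    refine PosSemidef.diagonal fun i => ?_
    have h2 : star (θ i) * θ i = ((‖θ i‖ ^ 2 : ℝ) : ℂ) := by
      rw [← Complex.normSq_eq_norm_sq, Complex.normSq_eq_conj_mul_self]; rfl
    have h3 : (0 : ℝ) ≤ 1 - ‖θ i‖ ^ 2 := by
      have := pow_le_one₀ (n := 2) (norm_nonneg _) (hθ i)
      linarith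
    simp only [Pi.zero_apply, h2]
    exact_mod_cast h3
  refine le_trans (le_of_eq ?_) ((conjTranspose_mul_mul_mono h1 V).trans (by simpa using hV))
  rw [conjTranspose_mul, diagonal_conjTranspose]
  simp only [Matrix.mul_assoc]
  rw [← Matrix.mul_assoc (diagonal (star θ)), diagonal_mul_diagonal]
  rfl

theorem exists_eq_mul_of_norm_le {ι : Type*} {d : ι → ℂ} {r : ι → ℝ} (h : ∀ i, ‖d i‖ ≤ r i) :
    ∃ θ : ι → ℂ, (∀ i, ‖θ i‖ ≤ 1) ∧ ∀ i, d i = r i * θ i := by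
  refine ⟨fun i => d i / r i, fun i => ?_, fun i => ?_⟩
  · have hr : 0 ≤ r i := (norm_nonneg _).trans (h i)
    rw [norm_div, Complex.norm_real, Real.norm_of_nonneg hr]
    exact div_le_one_of_le₀ (h i) hr
  · by_cases hr : r i = 0
    · have : d i = 0 := norm_le_zero_iff.1 (hr ▸ h i)
      simp [this]
    · have : (r i : ℂ) ≠ 0 := by exact_mod_cast hr
      field_simp

/-- Complex weights are split into their real bounds `r`, `s`, which go into `G` and `H`, and
factors of modulus at most one, which keep `U` and `V` contractions. -/
theorem sq_norm_det_diagonal_le {k l : ℕ} (hk1 : 1 ≤ k) (hk : k ≤ l) (G : Matrix N (Fin l) ℂ)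
    (H : Matrix M (Fin l) ℂ) {U : Matrix M (Fin k) ℂ} {V : Matrix N (Fin k) ℂ}
    (hU : Uᴴ * U ≤ 1) (hV : Vᴴ * V ≤ 1) {d : N → ℂ} {e : M → ℂ} {r : N → ℝ} {s : M → ℝ}
    (hd : ∀ i, ‖d i‖ ≤ r i) (he : ∀ i, ‖e i‖ ≤ s i) :
    ‖(Uᴴ * diagonal e * (H * Gᴴ) * (diagonal d * V)).det‖ ^ 2 ≤
      ∏ i : Fin l with i.val < k, eigs (sandwich
        (weightedGram G fun p => r p ^ 2)
        (weightedGram H fun p => s p ^ 2)) i := by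
  obtain ⟨θ, hθ, hdθ⟩ := exists_eq_mul_of_norm_le hd
  obtain ⟨η, hη, heη⟩ := exists_eq_mul_of_norm_le he
  have hη' : ∀ i, ‖star (η i)‖ ≤ 1 := fun i => by rw [norm_star]; exact hη i
  have key := sq_norm_det_le_prod_eigs hk1 hk (diagonal (fun p => (r p : ℂ)) * G)
    (diagonal (fun p => (s p : ℂ)) * H) (contraction_diagonal_mul hη' hU)
    (contraction_diagonal_mul hθ hV)
  rw [conjTranspose_diagonal_mul_self, conjTranspose_diagonal_mul_self] at key
  refine le_trans (le_of_eq ?_) key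
  congr 3
  have h1 : diagonal d = diagonal (fun p => (r p : ℂ)) * diagonal θ := by
    rw [diagonal_mul_diagonal]; congr 1; ext i; exact hdθ i
  have h2 : diagonal e = diagonal η * diagonal (fun p => (s p : ℂ)) := by
    rw [diagonal_mul_diagonal]; congr 1; ext i; rw [heη i, mul_comm]
  have h4 : (diagonal (fun i => star (η i)))ᴴ = diagonal η := by
    rw [diagonal_conjTranspose]; congr 1; ext i; simp
  rw [h1, h2, conjTranspose_mul, conjTranspose_mul, conjTranspose_diagonal_ofReal,
    h4]
  simp only [Matrix.mul_assoc]

/-! ### Holomorphic powers and determinants. -/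

/-- The entire function `z ↦ a ^ (z / 2)`, taken to be identically zero for `a = 0`. -/
noncomputable def halfPow (a : ℝ) (z : ℂ) : ℂ :=
  if a = 0 then 0 else Complex.exp (z / 2 * Real.log a)

theorem differentiable_halfPow (a : ℝ) : Differentiable ℂ (halfPow a) := by
  unfold halfPow
  split_ifs
  · exact differentiable_const _
  · fun_prop

/-- An inequality only: for `a = 0` and `z.re = 0` the left side is `0` and the right side is `0 ^ 0
= 1`. -/
theorem norm_halfPow_le {a : ℝ} (ha : 0 ≤ a) (z : ℂ) : ‖halfPow a z‖ ≤ a ^ (z.re / 2) := by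
  unfold halfPow
  split_ifs with h
  · rw [norm_zero]; exact Real.rpow_nonneg ha _
  · rw [Complex.norm_exp, Real.rpow_def_of_pos (lt_of_le_of_ne ha (Ne.symm h))]
    refine le_of_eq ?_
    congr 1
    rw [Complex.re_mul_ofReal, mul_comm]
    simp

theorem halfPow_ofReal {a t : ℝ} (ha : 0 ≤ a) (ht : 0 < t) :
    halfPow a (t : ℂ) = ((a ^ (t / 2) : ℝ) : ℂ) := by
  unfold halfPow
  split_ifs with h
  · rw [h, Real.zero_rpow (by positivity)]; simp
  · rw [Real.rpow_def_of_pos (lt_of_le_of_ne ha (Ne.symm h))]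
    push_cast
    rw [mul_comm]

theorem norm_halfPow_le_one_add {a : ℝ} (ha : 0 ≤ a) {z : ℂ} (h0 : 0 ≤ z.re) (h1 : z.re ≤ 1) :
    ‖halfPow a z‖ ≤ 1 + a := by
  refine (norm_halfPow_le ha z).trans ?_
  rcases le_total a 1 with h | h
  · exact (Real.rpow_le_one ha h (by linarith)).trans (by linarith)
  · calc a ^ (z.re / 2) ≤ a ^ (1 : ℝ) := Real.rpow_le_rpow_of_exponent_le h (by linarith)
      _ ≤ 1 + a := by rw [Real.rpow_one]; linarith

theorem differentiable_det_diagonal {k : Type*} [Fintype k] [DecidableEq k] (U : Matrix k M ℂ)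
    (K : Matrix M N ℂ) (V : Matrix N k ℂ) {d : ℂ → N → ℂ} {e : ℂ → M → ℂ}
    (hd : ∀ i, Differentiable ℂ fun z => d z i) (he : ∀ i, Differentiable ℂ fun z => e z i) :
    Differentiable ℂ fun z => (U * diagonal (e z) * K * (diagonal (d z) * V)).det := by
  have hentry : ∀ i j, Differentiable ℂ
      fun z => (U * diagonal (e z) * K * (diagonal (d z) * V)) i j := by
    intro i j
    have : ∀ z, (U * diagonal (e z) * K * (diagonal (d z) * V)) i j =
        ∑ q, (∑ p, U i p * e z p * K p q) * (d z q * V q j) := by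
      intro z
      rw [Matrix.mul_apply]
      refine Finset.sum_congr rfl fun q _ => ?_
      rw [Matrix.mul_apply, diagonal_mul]
      simp only [mul_diagonal]
    simp only [this]
    fun_prop
  simp only [det_apply]
  refine Differentiable.fun_sum fun σ _ => Differentiable.const_smul ?_ _
  exact Differentiable.fun_finsetProd fun i _ => hentry _ _

end Weighted

/-! ### Interpolation and conclusion. -/

theorem prod_eigs_le_of_mem_Ioo {n m l : ℕ} (Φ : CMat n →ₚ[ℂ] CMat l) (Ψ : CMat m →ₚ[ℂ] CMat l)
    {α : ℝ} (hα₀ : 0 < α) (hα₁ : α < 1) {A : CMat n} {B : CMat m} (hA : A.PosSemidef)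
    (hB : B.PosSemidef) {k : ℕ} (hk1 : 1 ≤ k) (hk : k ≤ l) :
    ∏ i : Fin l with i.val < k, eigs (sandwich (Φ (A ^ α)) (Ψ (B ^ α))) i ≤
      (∏ i : Fin l with i.val < k, eigs (sandwich (Φ 1) (Ψ 1)) i) ^ (1 - α) *
        (∏ i : Fin l with i.val < k, eigs (sandwich (Φ A) (Ψ B)) i) ^ α := by
  have hpsd : ∀ {X : CMat n} {Y : CMat m}, 0 ≤ Y → (sandwich (Φ X) (Ψ Y)).PosSemidef :=
    fun hY => sandwich_posSemidef _ (nonneg_iff_posSemidef.1 (Ψ.map_nonneg hY))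
  have hprod : ∀ {X : CMat n} {Y : CMat m}, 0 ≤ Y →
      0 ≤ ∏ i : Fin l with i.val < k, eigs (sandwich (Φ X) (Ψ Y)) i :=
    fun hY => Finset.prod_nonneg fun i _ => eigs_nonneg (hpsd hY) i
  have h0 := hprod (X := 1) (Y := 1) PosSemidef.one.nonneg
  have h1 := hprod (X := A) hB.nonneg
  -- Extremal isometries are available only for nonzero singular values; if one of the first `k`
  -- eigenvalues vanishes, the left side is `0`.
  by_cases hpos : ∀ i : Fin l, i.val < k → 0 < eigs (sandwich (Φ (A ^ α)) (Ψ (B ^ α))) i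
  swap
  · push Not at hpos
    obtain ⟨i, hi, hle⟩ := hpos
    rw [Finset.prod_eq_zero (i := i) (by simpa using hi)
      (le_antisymm hle (eigs_nonneg (hpsd CFC.rpow_nonneg) i))]
    positivity
  obtain ⟨a, G, ha, hG⟩ := Φ.exists_factorization hA
  obtain ⟨b, H, hb, hH⟩ := Ψ.exists_factorization hB
  set d : ℂ → Fin n × Fin l → ℂ := fun z p => halfPow (a p.1) z
  set e : ℂ → Fin m × Fin l → ℂ := fun z p => halfPow (b p.1) z
  set r : Fin n × Fin l → ℝ := fun p => a p.1 ^ (α / 2) with hr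
  set s : Fin m × Fin l → ℝ := fun p => b p.1 ^ (α / 2) with hs
  have hdr : d α = fun p => (r p : ℂ) := funext fun p => halfPow_ofReal (ha p.1) hα₀
  have hes : e α = fun p => (s p : ℂ) := funext fun p => halfPow_ofReal (hb p.1) hα₀
  have hpow : ∀ x : ℝ, 0 ≤ x → ∀ t : ℝ, 0 ≤ t → (x ^ (t / 2)) ^ 2 = x ^ t := by
    intro x hx t ht
    rw [sq, ← Real.rpow_add_of_nonneg hx (by positivity) (by positivity), add_halves]
  have hGα : weightedGram G (fun p => r p ^ 2) = Φ (A ^ α) := by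
    simp only [hr, hpow _ (ha _) α hα₀.le, hG α]
  have hHα : weightedGram H (fun p => s p ^ 2) = Ψ (B ^ α) := by
    simp only [hs, hpow _ (hb _) α hα₀.le, hH α]
  obtain ⟨U, V, hU, hV, hUV⟩ := exists_isometries_prod_eigs_eq hk
    (diagonal (fun p => (r p : ℂ)) * G) (diagonal (fun p => (s p : ℂ)) * H) (by
      rw [conjTranspose_diagonal_mul_self, conjTranspose_diagonal_mul_self, hGα, hHα]
      exact hpos)
  rw [conjTranspose_diagonal_mul_self, conjTranspose_diagonal_mul_self, hGα, hHα,
    conjTranspose_mul, conjTranspose_diagonal_ofReal] at hUV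
  set F : ℂ → ℂ := fun z => (Uᴴ * diagonal (e z) * (H * Gᴴ) * (diagonal (d z) * V)).det with hF
  have hFα : ‖F α‖ ^ 2 =
      ∏ i : Fin l with i.val < k, eigs (sandwich (Φ (A ^ α)) (Ψ (B ^ α))) i := by
    rw [← hUV, hF]
    simp only [hdr, hes, Matrix.mul_assoc]
  have hFdiff : Differentiable ℂ F := differentiable_det_diagonal _ _ _
    (fun p => differentiable_halfPow (a p.1)) (fun p => differentiable_halfPow (b p.1))
  have hbd : BddAbove ((norm ∘ F) '' Complex.HadamardThreeLines.verticalClosedStrip 0 1) := by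
    refine ⟨√(∏ i : Fin l with i.val < k, eigs (sandwich
      (weightedGram G fun p => (1 + a p.1) ^ 2) (weightedGram H fun p => (1 + b p.1) ^ 2)) i), ?_⟩
    rintro _ ⟨z, hz, rfl⟩
    have hz' : 0 ≤ z.re ∧ z.re ≤ 1 := hz
    exact Real.le_sqrt_of_sq_le (sq_norm_det_diagonal_le hk1 hk G H hU.le hV.le
      (fun p => norm_halfPow_le_one_add (ha p.1) hz'.1 hz'.2)
      (fun p => norm_halfPow_le_one_add (hb p.1) hz'.1 hz'.2))
  -- All weights are `1`, also where `a = 0`, matching the convention `A ^ 0 = 1`.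
  have hG0 : weightedGram G (fun _ => (1 : ℝ) ^ 2) = Φ 1 := by
    rw [← CFC.rpow_zero A hA.nonneg, hG 0]; simp
  have hH0 : weightedGram H (fun _ => (1 : ℝ) ^ 2) = Ψ 1 := by
    rw [← CFC.rpow_zero B hB.nonneg, hH 0]; simp
  have hG1 : weightedGram G (fun p => (a p.1 ^ ((1 : ℝ) / 2)) ^ 2) = Φ A := by
    simp only [hpow _ (ha _) 1 zero_le_one]
    rw [← hG 1, CFC.rpow_one A hA.nonneg]
  have hH1 : weightedGram H (fun p => (b p.1 ^ ((1 : ℝ) / 2)) ^ 2) = Ψ B := by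
    simp only [hpow _ (hb _) 1 zero_le_one]
    rw [← hH 1, CFC.rpow_one B hB.nonneg]
  have hleft : ∀ z ∈ Complex.re ⁻¹' {0},
      ‖F z‖ ≤ √(∏ i : Fin l with i.val < k, eigs (sandwich (Φ 1) (Ψ 1)) i) := by
    intro z hz
    have hz' : z.re = 0 := hz
    refine Real.le_sqrt_of_sq_le ?_
    rw [← hG0, ← hH0]
    refine sq_norm_det_diagonal_le hk1 hk G H hU.le hV.le (fun p => ?_) (fun p => ?_)
    · simpa [hz'] using norm_halfPow_le (ha p.1) z
    · simpa [hz'] using norm_halfPow_le (hb p.1) z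
  have hright : ∀ z ∈ Complex.re ⁻¹' {1},
      ‖F z‖ ≤ √(∏ i : Fin l with i.val < k, eigs (sandwich (Φ A) (Ψ B)) i) := by
    intro z hz
    have hz' : z.re = 1 := hz
    refine Real.le_sqrt_of_sq_le ?_
    rw [← hG1, ← hH1]
    refine sq_norm_det_diagonal_le hk1 hk G H hU.le hV.le (fun p => ?_) (fun p => ?_)
    · simpa [hz'] using norm_halfPow_le (ha p.1) z
    · simpa [hz'] using norm_halfPow_le (hb p.1) z
  have hthree := Complex.HadamardThreeLines.norm_le_interp_of_mem_verticalClosedStrip₀₁' F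
    (z := (α : ℂ)) (by
      show (α : ℂ).re ∈ Set.Icc (0 : ℝ) 1
      simpa using And.intro hα₀.le hα₁.le) hFdiff.diffContOnCl hbd hleft hright
  rw [Complex.ofReal_re] at hthree
  rw [← hFα]
  refine (pow_le_pow_left₀ (norm_nonneg _) hthree 2).trans (le_of_eq ?_)
  have hsq : ∀ (x t : ℝ), 0 ≤ x → (√x ^ t) ^ 2 = x ^ t := by
    intro x t hx
    rw [sq, ← Real.mul_rpow (Real.sqrt_nonneg _) (Real.sqrt_nonneg _), Real.mul_self_sqrt hx]
  rw [mul_pow, hsq _ _ h0, hsq _ _ h1]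

theorem corollary3p3 {n m l : ℕ} (Φ : CMat n →ₚ[ℂ] CMat l) (Ψ : CMat m →ₚ[ℂ] CMat l)
    (α : ℝ) (hα₀ : 0 ≤ α) (hα₁ : α ≤ 1) :
    (∀ (A : CMat n) (B : CMat m), A.PosSemidef → B.PosSemidef →
      WeakLogMaj (eigs (sandwich (Φ (A ^ α)) (Ψ (B ^ α))))
        (fun i => eigs (sandwich (Φ 1) (Ψ 1)) i ^ (1 - α) *
          eigs (sandwich (Φ A) (Ψ B)) i ^ α)) ∧
    (sandwich (Φ 1) (Ψ 1) ≤ 1 →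
      ∀ (A : CMat n) (B : CMat m), A.PosSemidef → B.PosSemidef →
        WeakLogMaj (eigs (sandwich (Φ (A ^ α)) (Ψ (B ^ α))))
          (fun i => eigs (sandwich (Φ A) (Ψ B)) i ^ α)) := by
  have hpsd : ∀ {X : CMat n} {Y : CMat m}, 0 ≤ Y → (sandwich (Φ X) (Ψ Y)).PosSemidef :=
    fun hY => sandwich_posSemidef _ (nonneg_iff_posSemidef.1 (Ψ.map_nonneg hY))
  have h0 : (sandwich (Φ 1) (Ψ 1)).PosSemidef := hpsd PosSemidef.one.nonneg
  have main : ∀ (A : CMat n) (B : CMat m), A.PosSemidef → B.PosSemidef →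
      WeakLogMaj (eigs (sandwich (Φ (A ^ α)) (Ψ (B ^ α))))
        (fun i => eigs (sandwich (Φ 1) (Ψ 1)) i ^ (1 - α) *
          eigs (sandwich (Φ A) (Ψ B)) i ^ α) := by
    intro A B hA hB k hk1 hk
    have h1 : (sandwich (Φ A) (Ψ B)).PosSemidef := hpsd hB.nonneg
    -- At the endpoints both sides agree. They are split off because `halfPow 0` vanishes at `z =
    -- 0`, and interpolation needs the true power at `α`.
    rcases hα₀.eq_or_lt with rfl | h0α
    · simp [CFC.rpow_zero A hA.nonneg, CFC.rpow_zero B hB.nonneg]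
    rcases hα₁.eq_or_lt with rfl | hα1
    · simp [CFC.rpow_one A hA.nonneg, CFC.rpow_one B hB.nonneg]
    rw [Finset.prod_mul_distrib, Real.finsetProd_rpow _ _ fun i _ => eigs_nonneg h0 i,
      Real.finsetProd_rpow _ _ fun i _ => eigs_nonneg h1 i]
    exact prod_eigs_le_of_mem_Ioo Φ Ψ h0α hα1 hA hB hk1 hk
  refine ⟨main, fun hle A B hA hB k hk1 hk => (main A B hA hB k hk1 hk).trans ?_⟩
  refine Finset.prod_le_prod (fun i _ => ?_) fun i _ => ?_
  · exact mul_nonneg (Real.rpow_nonneg (eigs_nonneg h0 i) _)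
      (Real.rpow_nonneg (eigs_nonneg (hpsd hB.nonneg) i) _)
  · exact mul_le_of_le_one_left (Real.rpow_nonneg (eigs_nonneg (hpsd hB.nonneg) i) _)
      (Real.rpow_le_one (eigs_nonneg h0 i) (eigs_le_one h0 hle i) (by linarith))
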